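/- Let $A\in\mathbb R^{m\times n}$, $b\in\mathbb R^m$, let $\sigma_1\ge\sigma_2\ge\cdots$ be the singular values of $A$ (with $\sigma_i=0$ for $i>\min(m,n)$), and let $1\le k<n$, $c>0$ and $0<\epsilon<1$. Let $A_k$ be a best approximation of $A$ in the spectral norm among matrices of rank at most $k$ (for example the rank-$k$ truncated SVD of $A$), and let $x_\star=A_k^{\dagger}b$, where $\dagger$ denotes the Moore–Penrose pseudoinverse. Let $S\in\mathbb R^{s\times m}$ (for example a count sketch matrix) satisfy $$\frac{1}{\sqrt{1+\epsilon}}\,\|SAx\|_2\le\|Ax\|_2\le\frac{1}{\sqrt{1-\epsilon}}\,\|SAx\|_2\qquad\text{for all }x\in\mathbb R^n.$$ Let $\tilde k$ be the effective rank of $\tilde A=SA$ found by the CSSVDP-LSQR method, that is, the number of singular values of $\tilde A$ that are larger than $c$ times the largest singular value of $\tilde A$. Let $\tilde A=U\Sigma V^T$ be any compact singular value decomposition with the singular values in non-increasing order, let $P=V_{\tilde k}\Sigma_{\tilde k}^{-1}$ be the preconditioner, where $V_{\tilde k}$ consists of the first $\tilde k$ columns of $V$ and $\Sigma_{\tilde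 k}$ is the leading $\tilde k\times\tilde k$ block of $\Sigma$, and let $\hat x=P(AP)^{\dagger}b$. If $$\sigma_{k+1}<c\,\sigma_1\sqrt{\frac{1-\epsilon}{1+\epsilon}}\qquad\text{and}\qquad \sigma_k>c\,\sigma_1\left(1+\sqrt{\frac{1+\epsilon}{1-\epsilon}}\right),$$ then $\tilde k=k$ and $$\|\hat x-x_\star\|_2\le\frac{6\,\|b\|_2}{\left(\sigma_k\sqrt{\frac{1-\epsilon}{1+\epsilon}}\right)\left(\sigma_k\sqrt{\frac{1-\epsilon}{1+\epsilon}}-\sigma_{k+1}\right)}\,\sigma_{k+1}.$$ -/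

import Mathlib

open scoped Matrix

/-- `X` is the Moore–Penrose pseudoinverse of the real matrix `M` (the four Penrose equations). -/
structure IsMoorePenrose {m n : Type*} [Fintype m] [Fintype n]
    (M : Matrix m n ℝ) (X : Matrix n m ℝ) : Prop where
  mul_mul_self : M * X * M = M
  self_mul_mul : X * M * X = X
  left_symm : (M * X)ᵀ = M * X
  right_symm : (X * M)ᵀ = X * M

theorem IsMoorePenrose.unique {m n : Type*} [Fintype m] [Fintype n]
    {M : Matrix m n ℝ} {X Y : Matrix n m ℝ}
    (hX : IsMoorePenrose M X) (hY : IsMoorePenrose M Y) : X = Y := by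
  have h1 : M * X = M * Y := by
    calc M * X = (M * X)ᵀ := hX.left_symm.symm
      _ = ((M * Y) * (M * X))ᵀ := by rw [← Matrix.mul_assoc, hY.mul_mul_self]
      _ = (M * X) * (M * Y) := by rw [Matrix.transpose_mul, hX.left_symm, hY.left_symm]
      _ = M * Y := by rw [← Matrix.mul_assoc, hX.mul_mul_self]
  have h2 : X * M = Y * M := by
    calc X * M = (X * M)ᵀ := hX.right_symm.symm
      _ = ((X * M) * (Y * M))ᵀ := by
          rw [Matrix.mul_assoc, ← Matrix.mul_assoc M, hY.mul_mul_self]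
      _ = (Y * M) * (X * M) := by rw [Matrix.transpose_mul, hX.right_symm, hY.right_symm]
      _ = Y * M := by rw [Matrix.mul_assoc, ← Matrix.mul_assoc M, hX.mul_mul_self]
  calc X = X * M * X := hX.self_mul_mul.symm
    _ = Y * (M * Y) := by rw [h2, Matrix.mul_assoc, h1]
    _ = Y := by rw [← Matrix.mul_assoc, hY.self_mul_mul]

theorem exists_isMoorePenrose {m n : Type*} [Fintype m] [Fintype n] (M : Matrix m n ℝ) :
    ∃ X : Matrix n m ℝ, IsMoorePenrose M X := by
  classical
  have hH : (Mᵀ * M).IsHermitian := by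
    simpa using Matrix.isHermitian_conjTranspose_mul_self M
  obtain ⟨U, d, hU, hM⟩ : ∃ (U : Matrix n n ℝ) (d : n → ℝ), Uᵀ * U = 1 ∧
      Mᵀ * M = U * Matrix.diagonal d * Uᵀ := by
    refine ⟨hH.eigenvectorUnitary, hH.eigenvalues, ?_, ?_⟩
    · have := Matrix.UnitaryGroup.star_mul_self hH.eigenvectorUnitary
      simpa [Matrix.star_eq_conjTranspose] using this
    · have := hH.spectral_theorem
      simpa [Unitary.conjStarAlgAut_apply, Matrix.star_eq_conjTranspose, Function.comp_def]
        using this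
  have key : ∀ a b : n → ℝ, (U * Matrix.diagonal a * Uᵀ) * (U * Matrix.diagonal b * Uᵀ) =
      U * Matrix.diagonal (fun i => a i * b i) * Uᵀ := by
    intro a b
    calc _ = U * Matrix.diagonal a * (Uᵀ * U) * Matrix.diagonal b * Uᵀ := by
          simp only [Matrix.mul_assoc]
      _ = _ := by rw [hU, Matrix.mul_one, Matrix.mul_assoc U, Matrix.diagonal_mul_diagonal]
  have symm : ∀ a : n → ℝ, (U * Matrix.diagonal a * Uᵀ)ᵀ = U * Matrix.diagonal a * Uᵀ := by
    intro a
    simp [Matrix.transpose_mul, Matrix.mul_assoc]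
  set G : Matrix n n ℝ := U * Matrix.diagonal (fun i => (d i)⁻¹) * Uᵀ with hG
  have hGt : Gᵀ = G := symm _
  have hHt : (Mᵀ * M)ᵀ = Mᵀ * M := by simp
  have h1 : (Mᵀ * M) * G * (Mᵀ * M) = Mᵀ * M := by
    rw [hM, hG, key, key]; simp
  have h2 : G * (Mᵀ * M) * G = G := by
    rw [hM, hG, key, key]
    congr 3; ext i
    by_cases h : d i = 0 <;> simp [h]
  have h3 : (G * (Mᵀ * M))ᵀ = G * (Mᵀ * M) := by
    rw [hM, hG, key, symm]
  have h4 : M * G * (Mᵀ * M) = M := by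
    have h0 : (M * G * (Mᵀ * M) - M)ᵀ * (M * G * (Mᵀ * M) - M) = 0 := by
      have e : (M * G * (Mᵀ * M) - M)ᵀ = (Mᵀ * M) * G * Mᵀ - Mᵀ := by
        rw [Matrix.transpose_sub, Matrix.transpose_mul, hHt, Matrix.transpose_mul, hGt,
          ← Matrix.mul_assoc]
      rw [e, Matrix.sub_mul]
      have e1 : (Mᵀ * M) * G * Mᵀ * (M * G * (Mᵀ * M) - M) =
          ((Mᵀ * M) * G * (Mᵀ * M)) * G * (Mᵀ * M) - (Mᵀ * M) * G * (Mᵀ * M) := by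
        simp only [Matrix.mul_sub, Matrix.mul_assoc]
      have e2 : Mᵀ * (M * G * (Mᵀ * M) - M) = (Mᵀ * M) * G * (Mᵀ * M) - Mᵀ * M := by
        simp only [Matrix.mul_sub, Matrix.mul_assoc]
      rw [e1, e2, h1, h1]; simp
    have := Matrix.conjTranspose_mul_self_eq_zero (A := M * G * (Mᵀ * M) - M)
    simp only [Matrix.conjTranspose_eq_transpose_of_trivial] at this
    exact sub_eq_zero.mp (this.mp h0)
  refine ⟨G * Mᵀ, ?_, ?_, ?_, ?_⟩
  · simpa only [Matrix.mul_assoc] using h4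
  · calc G * Mᵀ * M * (G * Mᵀ) = (G * (Mᵀ * M) * G) * Mᵀ := by simp only [Matrix.mul_assoc]
      _ = _ := by rw [h2]
  · simp [Matrix.transpose_mul, hGt, Matrix.mul_assoc]
  · rw [Matrix.mul_assoc]; exact h3

/-- The Moore–Penrose pseudoinverse `M†`. -/
noncomputable def pinv {m n : Type*} [Fintype m] [Fintype n] (M : Matrix m n ℝ) :
    Matrix n m ℝ :=
  (exists_isMoorePenrose M).choose

theorem pinv_spec {m n : Type*} [Fintype m] [Fintype n] (M : Matrix m n ℝ) :
    IsMoorePenrose M (pinv M) :=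
  (exists_isMoorePenrose M).choose_spec

/-- The `i`-th largest singular value `σ_i(M)`, counted from `i = 1` (with multiplicity, and `0`
beyond the number of columns). Mathlib counts singular values from `0`. -/
noncomputable def sigma {p q : ℕ} (M : Matrix (Fin p) (Fin q) ℝ) (i : ℕ) : ℝ :=
  (Matrix.toEuclideanLin M).singularValues (i - 1)

/-- The effective rank of `M` at relative threshold `c`: the number of singular values
of `M` that exceed `c` times the largest one; the others are treated as zero. -/
noncomputable def effectiveRank {p q : ℕ} (c : ℝ) (M : Matrix (Fin p) (Fin q) ℝ) : ℕ :=
  ((Finset.Icc 1 q).filter fun i => c * sigma M 1 < sigma M i).card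

/-- `M = U diag(d) Vᵀ` is a compact singular value decomposition: `U` and `V` have orthonormal
columns and the diagonal is positive and non-increasing (so the inner dimension `r` is
the rank of `M`). -/
structure IsCompactSVD {p q r : ℕ} (M : Matrix (Fin p) (Fin q) ℝ)
    (U : Matrix (Fin p) (Fin r) ℝ) (d : Fin r → ℝ) (V : Matrix (Fin q) (Fin r) ℝ) : Prop where
  left_orthonormal : Uᵀ * U = 1
  right_orthonormal : Vᵀ * V = 1
  diag_pos : ∀ i, 0 < d i
  diag_antitone : Antitone d
  eq_mul : M = U * Matrix.diagonal d * Vᵀ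

/-- The preconditioner `P = V_l Σ_l⁻¹` obtained by keeping only the `l` leading singular triplets
of a compact singular value decomposition with right factor `V` and diagonal `d`. -/
noncomputable def truncatedPreconditioner {q r : ℕ} (l : ℕ) (d : Fin r → ℝ)
    (V : Matrix (Fin q) (Fin r) ℝ) : Matrix (Fin q) {i : Fin r // (i : ℕ) < l} ℝ :=
  V.submatrix id Subtype.val * Matrix.diagonal fun i => (d i.val)⁻¹

open scoped Matrix.Norms.L2Operator in
/-- `B` is a best approximation of `M` in the spectral norm among the matrices of
rank at most `k`. -/
def IsBestRankApprox {p q : ℕ} (M : Matrix (Fin p) (Fin q) ℝ) (k : ℕ)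
    (B : Matrix (Fin p) (Fin q) ℝ) : Prop :=
  B.rank ≤ k ∧ ∀ C : Matrix (Fin p) (Fin q) ℝ, C.rank ≤ k → ‖M - B‖ ≤ ‖M - C‖

/-! Write `ρ = √((1 - ε) / (1 + ε))` and let `R` hold the `k` leading right singular vectors of
`SA`. Two facts reduce the theorem to a perturbation bound for pseudoinverses.

The embedding makes `‖SAx‖` and `‖Ax‖` comparable, so by a Courant–Fischer dimension count
(`le_mul_of_norm_le`) each singular value of `SA` lies within the factors `√(1 - ε)` and `√(1 + ε)`
of that of `A`. The two hypotheses then place the threshold between the `k`-th and the next one, so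
the effective rank is `k`.

The diagonal factor of `P` is invertible and `AR` is injective, so `P (AP)†` is the pseudoinverse of
`N = A R Rᵀ` (`isMoorePenrose_mul_pinv`). Both `N` and `A_k` have rank `k`, and a Wedin-type bound
gives `‖N† - A_k†‖ ≤ 3 ‖A_k†‖ ‖N†‖ ‖A_k - N‖` (`norm_sub_le_of_rank_eq`). Here `‖N†‖ ≤ 1 / (ρ σ_k)`,
`‖A_k†‖ ≤ 1 / (σ_k - σ_{k+1})` and `‖A_k - N‖ ≤ (1 + 1/ρ) σ_{k+1}`; the product is at most the
stated bound. -/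

open scoped Matrix.Norms.L2Operator

/-! ### Euclidean operator norms and orthogonal projections -/

namespace Matrix

section EuclideanLin

variable {l m n : Type*} [Fintype l] [Fintype n] [DecidableEq l] [DecidableEq n]

theorem toEuclideanLin_mul_apply (A : Matrix m n ℝ) (B : Matrix n l ℝ)
    (x : EuclideanSpace ℝ l) :
    toEuclideanLin (A * B) x = toEuclideanLin A (toEuclideanLin B x) := by
  simp only [toLpLin_mul_same, LinearMap.coe_comp, Function.comp_apply]

theorem toEuclideanLin_one_apply (x : EuclideanSpace ℝ n) :
    toEuclideanLin (1 : Matrix n n ℝ) x = x := by simp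

theorem toEuclideanLin_sub_apply (A B : Matrix m n ℝ) (x : EuclideanSpace ℝ n) :
    toEuclideanLin (A - B) x = toEuclideanLin A x - toEuclideanLin B x := by simp

theorem range_toEuclideanLin_mul_le (A : Matrix m n ℝ) (B : Matrix n l ℝ) :
    (toEuclideanLin (A * B)).range ≤ (toEuclideanLin A).range := by
  rintro _ ⟨x, rfl⟩
  exact ⟨toEuclideanLin B x, (toEuclideanLin_mul_apply A B x).symm⟩

variable [Fintype m]

theorem rank_eq_finrank_range_toEuclideanLin (A : Matrix m n ℝ) :
    A.rank = Module.finrank ℝ (toEuclideanLin A).range := by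
  rw [toEuclideanLin, toLpLin_eq_toLin]
  exact rank_eq_finrank_range_toLin _ _ _

theorem norm_toEuclideanLin_le (A : Matrix m n ℝ) (x : EuclideanSpace ℝ n) :
    ‖toEuclideanLin A x‖ ≤ ‖A‖ * ‖x‖ :=
  l2_opNorm_mulVec A x

theorem l2_opNorm_le_bound {A : Matrix m n ℝ} {C : ℝ} (hC : 0 ≤ C)
    (h : ∀ x : EuclideanSpace ℝ n, ‖toEuclideanLin A x‖ ≤ C * ‖x‖) : ‖A‖ ≤ C := by
  rw [l2_opNorm_def]
  exact ContinuousLinearMap.opNorm_le_bound _ hC h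

theorem rank_eq_card_of_injective {A : Matrix m n ℝ}
    (h : Function.Injective (toEuclideanLin A)) : A.rank = Fintype.card n := by
  rw [rank_eq_finrank_range_toEuclideanLin, LinearMap.finrank_range_of_inj h,
    finrank_euclideanSpace]

theorem range_toEuclideanLin_mul_eq {A : Matrix m n ℝ} {B : Matrix n l ℝ}
    (h : A.rank ≤ (A * B).rank) :
    (toEuclideanLin (A * B)).range = (toEuclideanLin A).range := by
  refine Submodule.eq_of_le_of_finrank_le (range_toEuclideanLin_mul_le A B) ?_
  rwa [← rank_eq_finrank_range_toEuclideanLin, ← rank_eq_finrank_range_toEuclideanLin]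

variable [DecidableEq m]

theorem inner_toEuclideanLin_left (A : Matrix m n ℝ) (x : EuclideanSpace ℝ n)
    (y : EuclideanSpace ℝ m) :
    inner ℝ (toEuclideanLin A x) y = inner ℝ x (toEuclideanLin Aᵀ y) := by
  rw [← conjTranspose_eq_transpose_of_trivial, toEuclideanLin_conjTranspose_eq_adjoint,
    LinearMap.adjoint_inner_right]

theorem norm_toEuclideanLin_sq (A : Matrix m n ℝ) (x : EuclideanSpace ℝ n) :
    ‖toEuclideanLin A x‖ ^ 2 = inner ℝ x (toEuclideanLin (Aᵀ * A) x) := by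
  rw [← real_inner_self_eq_norm_sq, inner_toEuclideanLin_left, toEuclideanLin_mul_apply]

theorem norm_toEuclideanLin_of_transpose_mul_self {V : Matrix m n ℝ} (hV : Vᵀ * V = 1)
    (x : EuclideanSpace ℝ n) : ‖toEuclideanLin V x‖ = ‖x‖ := by
  rw [← sq_eq_sq₀ (norm_nonneg _) (norm_nonneg _), norm_toEuclideanLin_sq, hV,
    toEuclideanLin_one_apply, real_inner_self_eq_norm_sq]

theorem l2_opNorm_transpose (A : Matrix m n ℝ) : ‖Aᵀ‖ = ‖A‖ := by
  rw [← conjTranspose_eq_transpose_of_trivial, l2_opNorm_conjTranspose]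

end EuclideanLin

section Projection

variable {n : Type*} [Fintype n]

theorem transpose_eq_of_isStarProjection {P : Matrix n n ℝ} (hP : IsStarProjection P) :
    Pᵀ = P := by
  rw [← conjTranspose_eq_transpose_of_trivial]
  exact hP.isSelfAdjoint

theorem isStarProjection_of_transpose {P : Matrix n n ℝ} (h : Pᵀ = P) (h' : P * P = P) :
    IsStarProjection P :=
  ⟨h', by
    rw [isSelfAdjoint_iff, star_eq_conjTranspose, conjTranspose_eq_transpose_of_trivial, h]⟩

variable [DecidableEq n]

theorem norm_sq_add_norm_sq_of_isStarProjection {P : Matrix n n ℝ} (hP : IsStarProjection P)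
    (x : EuclideanSpace ℝ n) :
    ‖toEuclideanLin P x‖ ^ 2 + ‖toEuclideanLin (1 - P) x‖ ^ 2 = ‖x‖ ^ 2 := by
  rw [norm_toEuclideanLin_sq, norm_toEuclideanLin_sq, transpose_eq_of_isStarProjection hP,
    transpose_eq_of_isStarProjection hP.one_sub, hP.isIdempotentElem.eq,
    hP.one_sub.isIdempotentElem.eq, ← inner_add_right, toEuclideanLin_sub_apply,
    toEuclideanLin_one_apply, add_sub_cancel, real_inner_self_eq_norm_sq]

/-- For two orthogonal projections of equal rank, the gap is symmetric. -/
theorem norm_one_sub_mul_le_of_rank_eq {P Q : Matrix n n ℝ} (hP : IsStarProjection P)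
    (hQ : IsStarProjection Q) (hr : P.rank = Q.rank) : ‖(1 - P) * Q‖ ≤ ‖(1 - Q) * P‖ := by
  set t := ‖(1 - Q) * P‖ with ht
  have ht0 : 0 ≤ t := norm_nonneg _
  rcases le_or_gt 1 t with h1 | h1
  · calc ‖(1 - P) * Q‖ ≤ ‖1 - P‖ * ‖Q‖ := norm_mul_le _ _
      _ ≤ 1 * 1 := mul_le_mul hP.one_sub.norm_le hQ.norm_le (norm_nonneg _) zero_le_one
      _ ≤ t := by linarith
  have hbound : ∀ u, toEuclideanLin P u = u → ‖toEuclideanLin (1 - Q) u‖ ≤ t * ‖u‖ := by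
    intro u hu
    have := norm_toEuclideanLin_le ((1 - Q) * P) u
    rwa [toEuclideanLin_mul_apply, hu] at this
  have hPP : ∀ x, toEuclideanLin P (toEuclideanLin P x) = toEuclideanLin P x := fun x => by
    rw [← toEuclideanLin_mul_apply, hP.isIdempotentElem.eq]
  have hQQ : ∀ x, toEuclideanLin Q (toEuclideanLin Q x) = toEuclideanLin Q x := fun x => by
    rw [← toEuclideanLin_mul_apply, hQ.isIdempotentElem.eq]
  -- `Q` is injective on the range of `P`, so it maps it onto the range of `Q`
  have hker : (toEuclideanLin (Q * P)).ker = (toEuclideanLin P).ker := by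
    ext x
    simp only [LinearMap.mem_ker, toEuclideanLin_mul_apply]
    refine ⟨fun h => ?_, fun h => by rw [h, map_zero]⟩
    -- If `QPx = 0`, then `‖Px‖ = ‖(1 - Q)Px‖ ≤ t‖Px‖` with `t < 1`, so `Px = 0`.
    have h2 := hbound _ (hPP x)
    rw [toEuclideanLin_sub_apply, toEuclideanLin_one_apply, h, sub_zero] at h2
    rw [← norm_eq_zero]
    nlinarith [norm_nonneg (toEuclideanLin P x)]
  have hrank : (Q * P).rank = Q.rank := by
    have e1 := (toEuclideanLin (Q * P)).finrank_range_add_finrank_ker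
    have e2 := (toEuclideanLin P).finrank_range_add_finrank_ker
    rw [hker] at e1
    rw [← hr, rank_eq_finrank_range_toEuclideanLin, rank_eq_finrank_range_toEuclideanLin]
    omega
  refine l2_opNorm_le_bound ht0 fun y => ?_
  rw [toEuclideanLin_mul_apply]
  obtain ⟨x, hx⟩ : toEuclideanLin Q y ∈ (toEuclideanLin (Q * P)).range := by
    rw [range_toEuclideanLin_mul_eq hrank.ge]
    exact ⟨y, rfl⟩
  rw [toEuclideanLin_mul_apply] at hx
  set u := toEuclideanLin P x with hu
  set w := toEuclideanLin Q y with hw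
  have hPu : toEuclideanLin P u = u := hPP x
  have hwy : ‖w‖ ≤ ‖y‖ := by
    have := norm_sq_add_norm_sq_of_isStarProjection hQ y
    exact le_of_sq_le_sq (by nlinarith [sq_nonneg ‖toEuclideanLin (1 - Q) y‖]) (norm_nonneg _)
  refine le_trans ?_ (mul_le_mul_of_nonneg_left hwy ht0)
  -- With `w = Qu` and `u = Pu`, Cauchy–Schwarz gives `‖w‖² ≤ ‖Pw‖ ‖u‖`, while `‖w‖² ≥ (1 -
  -- t²)‖u‖²`. Together `‖Pw‖² ≥ (1 - t²)‖w‖²`, that is, `‖(1 - P)w‖ ≤ t‖w‖`.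
  have e1 : ‖w‖ ^ 2 = inner ℝ (toEuclideanLin P w) u := by
    rw [inner_toEuclideanLin_left, transpose_eq_of_isStarProjection hP, hPu,
      ← real_inner_self_eq_norm_sq]
    calc inner ℝ w w = inner ℝ w (toEuclideanLin Qᵀ u) := by
          rw [transpose_eq_of_isStarProjection hQ, hx]
      _ = inner ℝ w u := by rw [← inner_toEuclideanLin_left, hw, hQQ]
  have e2 : ‖w‖ ^ 2 ≤ ‖toEuclideanLin P w‖ * ‖u‖ := e1 ▸ real_inner_le_norm _ _
  have e3 := norm_sq_add_norm_sq_of_isStarProjection hQ u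
  have e4 := norm_sq_add_norm_sq_of_isStarProjection hP w
  have e5 := hbound u hPu
  rw [hx] at e3
  have e6 : ‖toEuclideanLin (1 - Q) u‖ ^ 2 ≤ t ^ 2 * ‖u‖ ^ 2 := by
    rw [← mul_pow]; exact pow_le_pow_left₀ (norm_nonneg _) e5 2
  refine le_of_sq_le_sq ?_ (by positivity)
  rw [mul_pow]
  by_cases hu0 : ‖u‖ = 0
  · have : ‖w‖ ^ 2 = 0 := by
      rw [hu0] at e2; nlinarith [sq_nonneg ‖w‖]
    rw [this] at e4 ⊢
    nlinarith [sq_nonneg ‖toEuclideanLin P w‖]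
  have hu2 : 0 < ‖u‖ ^ 2 := by positivity
  have e7 : (‖w‖ ^ 2) ^ 2 ≤ ‖toEuclideanLin P w‖ ^ 2 * ‖u‖ ^ 2 := by
    rw [← mul_pow]; exact pow_le_pow_left₀ (sq_nonneg _) e2 2
  have e8 : ‖w‖ ^ 2 * ((1 - t ^ 2) * ‖u‖ ^ 2) ≤ ‖w‖ ^ 2 * ‖w‖ ^ 2 :=
    mul_le_mul_of_nonneg_left (by linarith) (sq_nonneg _)
  have e9 : (‖w‖ ^ 2 * (1 - t ^ 2)) * ‖u‖ ^ 2 ≤ ‖toEuclideanLin P w‖ ^ 2 * ‖u‖ ^ 2 := by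
    linarith
  have := le_of_mul_le_mul_right e9 hu2
  linarith

end Projection

end Matrix

/-! ### Perturbation of pseudoinverses -/

namespace IsMoorePenrose

open Matrix

variable {m n : Type*} [Fintype m] [Fintype n] {M N : Matrix m n ℝ} {X Y : Matrix n m ℝ}

theorem isStarProjection_left (hX : IsMoorePenrose M X) : IsStarProjection (M * X) :=
  isStarProjection_of_transpose hX.left_symm (by
    rw [← Matrix.mul_assoc, hX.mul_mul_self])

theorem isStarProjection_right (hX : IsMoorePenrose M X) : IsStarProjection (X * M) :=
  isStarProjection_of_transpose hX.right_symm (by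
    rw [← Matrix.mul_assoc, hX.self_mul_mul])

theorem rank_left (hX : IsMoorePenrose M X) : (M * X).rank = M.rank := by
  refine le_antisymm (rank_mul_le_left _ _) ?_
  nth_rewrite 1 [← hX.mul_mul_self]
  exact rank_mul_le_left _ _

theorem rank_right (hX : IsMoorePenrose M X) : (X * M).rank = M.rank := by
  refine le_antisymm (rank_mul_le_right _ _) ?_
  nth_rewrite 1 [← hX.mul_mul_self]
  rw [Matrix.mul_assoc]
  exact rank_mul_le_right _ _

variable [DecidableEq m] [DecidableEq n]

/-- Perturbation bound for pseudoinverses of matrices of equal rank. -/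
theorem norm_sub_le_of_rank_eq (hX : IsMoorePenrose M X) (hY : IsMoorePenrose N Y)
    (hr : M.rank = N.rank) : ‖Y - X‖ ≤ 3 * (‖X‖ * ‖Y‖ * ‖M - N‖) := by
  -- Wedin's decomposition; each of its three terms contributes one copy of `‖X‖ ‖Y‖ ‖M - N‖`.
  have hdec : Y - X = Y * (M - N) * X + Y * ((N * Y) * (1 - M * X)) -
      (1 - Y * N) * (X * M) * X := by
    have e1 : Y * ((N * Y) * (1 - M * X)) = Y - Y * M * X := by
      rw [← Matrix.mul_assoc, ← Matrix.mul_assoc, hY.self_mul_mul, Matrix.mul_sub,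
        Matrix.mul_one, Matrix.mul_assoc]
    have e2 : (1 - Y * N) * (X * M) * X = X - Y * N * X := by
      rw [Matrix.mul_assoc, hX.self_mul_mul, Matrix.sub_mul, Matrix.one_mul]
    rw [e1, e2, Matrix.mul_sub, Matrix.sub_mul]
    abel
  -- Equality of ranks allows the two projections to be exchanged. In the exchanged product `(1 -
  -- NY)N = 0` brings out `M - N` next to `X`, which keeps the bound free of `‖Y‖²`.
  have hl : ‖(N * Y) * (1 - M * X)‖ ≤ ‖M - N‖ * ‖X‖ := by
    have ht : (N * Y) * (1 - M * X) = ((1 - M * X) * (N * Y))ᵀ := by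
      rw [transpose_mul, hY.left_symm, transpose_sub, transpose_one, hX.left_symm]
    rw [ht, l2_opNorm_transpose]
    refine (norm_one_sub_mul_le_of_rank_eq hX.isStarProjection_left hY.isStarProjection_left
      (by rw [hX.rank_left, hY.rank_left, hr])).trans ?_
    have e : (1 - N * Y) * (M * X) = (1 - N * Y) * ((M - N) * X) := by
      rw [Matrix.sub_mul M N X, Matrix.mul_sub (1 - N * Y), Matrix.sub_mul 1 (N * Y) (N * X),
        ← Matrix.mul_assoc (N * Y) N X, hY.mul_mul_self, Matrix.one_mul, sub_self, sub_zero]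
    rw [e]
    calc _ ≤ ‖1 - N * Y‖ * ‖(M - N) * X‖ := l2_opNorm_mul _ _
      _ ≤ 1 * (‖M - N‖ * ‖X‖) := mul_le_mul hY.isStarProjection_left.one_sub.norm_le
          (l2_opNorm_mul _ _) (norm_nonneg _) zero_le_one
      _ = _ := one_mul _
  have hr' : ‖(1 - Y * N) * (X * M)‖ ≤ ‖Y‖ * ‖M - N‖ := by
    refine (norm_one_sub_mul_le_of_rank_eq hY.isStarProjection_right hX.isStarProjection_right
      (by rw [hX.rank_right, hY.rank_right, hr])).trans ?_
    have ht : (1 - X * M) * (Y * N) = ((Y * N) * (1 - X * M))ᵀ := by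
      rw [transpose_mul, hY.right_symm, transpose_sub, transpose_one, hX.right_symm]
    have e : (Y * N) * (1 - X * M) = -(Y * (M - N) * (1 - X * M)) := by
      rw [Matrix.mul_sub Y M N, Matrix.sub_mul (Y * M), Matrix.mul_sub (Y * M),
        Matrix.mul_assoc Y M (X * M), ← Matrix.mul_assoc M X M, hX.mul_mul_self,
        Matrix.mul_one, sub_self, zero_sub, neg_neg]
    rw [ht, l2_opNorm_transpose, e, norm_neg]
    calc _ ≤ ‖Y * (M - N)‖ * ‖1 - X * M‖ := l2_opNorm_mul _ _
      _ ≤ (‖Y‖ * ‖M - N‖) * 1 := mul_le_mul (l2_opNorm_mul _ _)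
          hX.isStarProjection_right.one_sub.norm_le (norm_nonneg _) (by positivity)
      _ = _ := mul_one _
  have h1 : ‖Y * (M - N) * X‖ ≤ ‖Y‖ * ‖M - N‖ * ‖X‖ :=
    (l2_opNorm_mul _ _).trans (mul_le_mul_of_nonneg_right (l2_opNorm_mul _ _) (norm_nonneg _))
  have h2 : ‖Y * ((N * Y) * (1 - M * X))‖ ≤ ‖Y‖ * (‖M - N‖ * ‖X‖) :=
    (l2_opNorm_mul _ _).trans (mul_le_mul_of_nonneg_left hl (norm_nonneg _))
  have h3 : ‖(1 - Y * N) * (X * M) * X‖ ≤ ‖Y‖ * ‖M - N‖ * ‖X‖ :=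
    (l2_opNorm_mul _ _).trans (mul_le_mul_of_nonneg_right hr' (norm_nonneg _))
  rw [hdec]
  refine (norm_sub_le _ _).trans ((add_le_add_left (norm_add_le _ _) _).trans ?_)
  linarith

/-- If `M` is bounded below on the span of the columns of `R`, whose number is at least the rank
of `M`, then it has this rank and its pseudoinverse is bounded. -/
theorem rank_eq_and_norm_le {ι : Type*} [Fintype ι] [DecidableEq ι] (hX : IsMoorePenrose M X)
    {R : Matrix n ι ℝ} {δ : ℝ} (hδ : 0 < δ) (hR : Rᵀ * R = 1)
    (hM : ∀ z, δ * ‖z‖ ≤ ‖toEuclideanLin M (toEuclideanLin R z)‖)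
    (hrank : M.rank ≤ Fintype.card ι) : M.rank = Fintype.card ι ∧ ‖X‖ ≤ 1 / δ := by
  have hinj : Function.Injective (toEuclideanLin (M * R)) := by
    rw [injective_iff_map_eq_zero]
    intro z hz
    have := hM z
    rw [← toEuclideanLin_mul_apply, hz, norm_zero] at this
    rw [← norm_eq_zero]
    nlinarith [norm_nonneg z]
  have hMR := rank_eq_card_of_injective hinj
  have hMr : M.rank ≤ (M * R).rank := hMR ▸ hrank
  refine ⟨le_antisymm hrank (hMR ▸ rank_mul_le_left _ _),
    l2_opNorm_le_bound (by positivity) fun y => ?_⟩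
  -- By rank, `MR` already fills the range of `M`, so `MXy = MRz` for some `z`. Then `Xy = XMRz`
  -- gives `‖Xy‖ ≤ ‖z‖`, and `δ‖z‖ ≤ ‖MXy‖ ≤ ‖y‖`.
  obtain ⟨z, hz⟩ : toEuclideanLin M (toEuclideanLin X y) ∈ (toEuclideanLin (M * R)).range := by
    rw [range_toEuclideanLin_mul_eq hMr]
    exact ⟨_, rfl⟩
  rw [toEuclideanLin_mul_apply] at hz
  have hXy : toEuclideanLin X y =
      toEuclideanLin (X * M) (toEuclideanLin R z) := by
    rw [toEuclideanLin_mul_apply, hz, ← toEuclideanLin_mul_apply, ← toEuclideanLin_mul_apply,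
      hX.self_mul_mul]
  have h1 : ‖toEuclideanLin X y‖ ≤ ‖z‖ := by
    rw [hXy, ← norm_toEuclideanLin_of_transpose_mul_self hR z]
    refine (norm_toEuclideanLin_le _ _).trans (mul_le_of_le_one_left (norm_nonneg _) ?_)
    exact hX.isStarProjection_right.norm_le
  have h2 : δ * ‖z‖ ≤ ‖y‖ := by
    refine (hM z).trans ?_
    rw [hz, ← toEuclideanLin_mul_apply]
    refine (norm_toEuclideanLin_le _ _).trans (mul_le_of_le_one_left (norm_nonneg _) ?_)
    exact hX.isStarProjection_left.norm_le
  rw [one_div, ← div_eq_inv_mul, le_div_iff₀ hδ]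
  nlinarith

end IsMoorePenrose

/-! ### Variational bounds for singular values -/

/-- The columns of `V` are orthonormal right singular vectors of `M` that belong to the singular
values `d 0 ≥ d 1 ≥ ⋯`, and all the other singular values of `M` vanish. -/
structure IsRightSingularSystem {p q r : ℕ} (M : Matrix (Fin p) (Fin q) ℝ)
    (V : Matrix (Fin q) (Fin r) ℝ) (d : ℕ → ℝ) : Prop where
  orthonormal : Vᵀ * V = 1
  antitone : Antitone d
  nonneg : ∀ i, 0 ≤ d i
  eq_zero : ∀ i, r ≤ i → d i = 0
  gram : Mᵀ * M = V * Matrix.diagonal (fun i : Fin r => d i ^ 2) * Vᵀ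

/-- The first `l` columns of a matrix. -/
def leadingColumns {q r : ℕ} (l : ℕ) (V : Matrix (Fin q) (Fin r) ℝ) :
    Matrix (Fin q) {i : Fin r // (i : ℕ) < l} ℝ :=
  V.submatrix id Subtype.val

theorem card_subtype_val_lt {r l : ℕ} (h : l ≤ r) :
    Fintype.card {i : Fin r // (i : ℕ) < l} = l := by
  rw [Fintype.card_subtype]
  have : (Finset.univ.filter fun i : Fin r => (i : ℕ) < l) =
      Finset.univ.map (Fin.castLEEmb h) := by
    ext i
    simp only [Finset.mem_filter, Finset.mem_univ, true_and, Finset.mem_map, Fin.castLEEmb_apply]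
    exact ⟨fun hi => ⟨⟨i, hi⟩, rfl⟩, by rintro ⟨j, rfl⟩; exact j.2⟩
  rw [this, Finset.card_map, Finset.card_univ, Fintype.card_fin]

theorem card_subtype_val_lt_le {r l : ℕ} :
    Fintype.card {i : Fin r // (i : ℕ) < l} ≤ l := by
  rcases le_total l r with h | h
  · exact (card_subtype_val_lt h).le
  · exact (Fintype.card_subtype_le _).trans (by simpa using h)

theorem Matrix.inner_toEuclideanLin_diagonal {ι : Type*} [Fintype ι] [DecidableEq ι]
    (e : ι → ℝ) (z : EuclideanSpace ℝ ι) :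
    inner ℝ z (toEuclideanLin (diagonal e) z) = ∑ i, e i * z i ^ 2 := by
  rw [PiLp.inner_apply]
  refine Finset.sum_congr rfl fun i _ => ?_
  simp [mulVec_diagonal]
  ring

namespace IsRightSingularSystem

open Matrix

variable {p q r : ℕ} {M : Matrix (Fin p) (Fin q) ℝ} {V : Matrix (Fin q) (Fin r) ℝ} {d : ℕ → ℝ}

theorem leadingColumns_orthonormal (h : IsRightSingularSystem M V d) (l : ℕ) :
    (leadingColumns l V)ᵀ * leadingColumns l V = 1 := by
  rw [leadingColumns, transpose_submatrix, ← submatrix_mul _ _ _ _ _ Function.bijective_id,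
    h.orthonormal, submatrix_one _ Subtype.val_injective]

theorem norm_sq_apply (h : IsRightSingularSystem M V d) (x : EuclideanSpace ℝ (Fin q)) :
    ‖toEuclideanLin M x‖ ^ 2 = ∑ i : Fin r, d i ^ 2 * (toEuclideanLin Vᵀ x) i ^ 2 := by
  rw [norm_toEuclideanLin_sq, h.gram, toEuclideanLin_mul_apply, toEuclideanLin_mul_apply,
    ← Matrix.inner_toEuclideanLin_diagonal, inner_toEuclideanLin_left, transpose_transpose]

theorem transpose_leadingColumns_apply (l : ℕ) (x : EuclideanSpace ℝ (Fin q))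
    (i : {i : Fin r // (i : ℕ) < l}) :
    toEuclideanLin (leadingColumns l V)ᵀ x i = toEuclideanLin Vᵀ x i.val := rfl

theorem sum_sq_apply_le (h : IsRightSingularSystem M V d) (x : EuclideanSpace ℝ (Fin q)) :
    ∑ i : Fin r, (toEuclideanLin Vᵀ x) i ^ 2 ≤ ‖x‖ ^ 2 := by
  have hV : ‖V‖ ≤ 1 := l2_opNorm_le_bound zero_le_one fun z => by
    rw [norm_toEuclideanLin_of_transpose_mul_self h.orthonormal, one_mul]
  have h1 : ‖toEuclideanLin Vᵀ x‖ ≤ ‖x‖ :=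
    (norm_toEuclideanLin_le _ _).trans
      (mul_le_of_le_one_left (norm_nonneg _) (by rwa [l2_opNorm_transpose]))
  have h2 := pow_le_pow_left₀ (norm_nonneg _) h1 2
  rwa [EuclideanSpace.norm_sq_eq, Finset.sum_congr rfl fun i _ => by
    rw [Real.norm_eq_abs, sq_abs]] at h2

/-- The upper half of Courant–Fischer: only terms with index at least `l` survive in `∑ dᵢ²
(Vᵀx)ᵢ²`. As `d` counts from `0`, `d l` is the singular value after the first `l`. -/
theorem norm_apply_le_of_leadingColumns_eq_zero (h : IsRightSingularSystem M V d) {l : ℕ}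
    {x : EuclideanSpace ℝ (Fin q)} (hx : toEuclideanLin (leadingColumns l V)ᵀ x = 0) :
    ‖toEuclideanLin M x‖ ≤ d l * ‖x‖ := by
  refine le_of_sq_le_sq ?_ (mul_nonneg (h.nonneg l) (norm_nonneg _))
  rw [h.norm_sq_apply, mul_pow]
  calc _ ≤ ∑ i : Fin r, d l ^ 2 * (toEuclideanLin Vᵀ x) i ^ 2 := by
        refine Finset.sum_le_sum fun i _ => ?_
        rcases lt_or_ge (i : ℕ) l with hi | hi
        · have : toEuclideanLin Vᵀ x i = 0 := by
            rw [← transpose_leadingColumns_apply l x ⟨i, hi⟩, hx]; rfl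
          rw [this]; simp
        · exact mul_le_mul_of_nonneg_right (pow_le_pow_left₀ (h.nonneg _) (h.antitone hi) 2)
            (sq_nonneg _)
    _ ≤ d l ^ 2 * ‖x‖ ^ 2 := by
        rw [← Finset.mul_sum]
        exact mul_le_mul_of_nonneg_left (h.sum_sq_apply_le x) (sq_nonneg _)

/-- The singular value that follows the `l` leading ones bounds `M` off their singular vectors. -/
theorem norm_mul_one_sub_le (h : IsRightSingularSystem M V d) (l : ℕ)
    (x : EuclideanSpace ℝ (Fin q)) :
    ‖toEuclideanLin M
      (toEuclideanLin (1 - leadingColumns l V * (leadingColumns l V)ᵀ) x)‖ ≤ d l * ‖x‖ := by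
  set R := leadingColumns l V
  have hR : Rᵀ * R = 1 := h.leadingColumns_orthonormal l
  have hP : IsStarProjection (R * Rᵀ) := isStarProjection_of_transpose (by simp) (by
    rw [Matrix.mul_assoc, ← Matrix.mul_assoc Rᵀ, hR, Matrix.one_mul])
  refine (h.norm_apply_le_of_leadingColumns_eq_zero (l := l) ?_).trans
    (mul_le_mul_of_nonneg_left ?_ (h.nonneg l))
  · rw [← toEuclideanLin_mul_apply, Matrix.mul_sub, ← Matrix.mul_assoc, hR, Matrix.mul_one,
      Matrix.one_mul, sub_self, map_zero, LinearMap.zero_apply]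
  · exact (norm_toEuclideanLin_le _ _).trans
      (mul_le_of_le_one_left (norm_nonneg _) hP.one_sub.norm_le)

/-- The last one of the `l + 1` leading singular values bounds `M` from below on their singular
vectors. -/
theorem le_norm_apply_leadingColumns (h : IsRightSingularSystem M V d) (l : ℕ)
    (z : EuclideanSpace ℝ {i : Fin r // (i : ℕ) < l + 1}) :
    d l * ‖z‖ ≤ ‖toEuclideanLin M (toEuclideanLin (leadingColumns (l + 1) V) z)‖ := by
  refine le_of_sq_le_sq ?_ (norm_nonneg _)
  set x := toEuclideanLin (leadingColumns (l + 1) V) z with hx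
  have hz : ∀ i, z i = toEuclideanLin Vᵀ x i.val := by
    intro i
    rw [← transpose_leadingColumns_apply (l + 1), hx, ← toEuclideanLin_mul_apply,
      h.leadingColumns_orthonormal, toEuclideanLin_one_apply]
  rw [h.norm_sq_apply, mul_pow, EuclideanSpace.norm_sq_eq, Finset.mul_sum]
  calc _ ≤ ∑ i : {i : Fin r // (i : ℕ) < l + 1},
        d i.val ^ 2 * (toEuclideanLin Vᵀ x) i.val ^ 2 := by
        refine Finset.sum_le_sum fun i _ => ?_
        rw [Real.norm_eq_abs, sq_abs, hz]
        exact mul_le_mul_of_nonneg_right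
          (pow_le_pow_left₀ (h.nonneg _) (h.antitone (Nat.le_of_lt_succ i.2)) 2) (sq_nonneg _)
    _ = ∑ i ∈ Finset.univ.filter fun i : Fin r => (i : ℕ) < l + 1,
        d i ^ 2 * (toEuclideanLin Vᵀ x) i ^ 2 :=
        (Finset.sum_subtype _ (by simp) fun i : Fin r =>
          d i ^ 2 * (toEuclideanLin Vᵀ x) i ^ 2).symm
    _ ≤ _ := Finset.sum_le_sum_of_subset_of_nonneg (Finset.filter_subset _ _)
        fun i _ _ => by positivity

/-- Singular values are monotone in the norms `‖M x‖`. -/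
theorem le_mul_of_norm_le {p' r' : ℕ} {M' : Matrix (Fin p') (Fin q) ℝ}
    {V' : Matrix (Fin q) (Fin r') ℝ} {d' : ℕ → ℝ} (h : IsRightSingularSystem M V d)
    (h' : IsRightSingularSystem M' V' d') {a : ℝ} (ha : 0 ≤ a)
    (hle : ∀ x, ‖toEuclideanLin M x‖ ≤ a * ‖toEuclideanLin M' x‖) (i : ℕ) :
    d i ≤ a * d' i := by
  rcases le_or_gt r i with hi | hi
  · rw [h.eq_zero i hi]
    exact mul_nonneg ha (h'.nonneg i)
  set R := leadingColumns (i + 1) V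
  -- The `i + 1` leading vectors of `M` against at most `i` of `M'`: some nonzero `Rz` is orthogonal
  -- to all the latter, and there the lower bound for `M` meets the upper bound for `M'`.
  have hker : (toEuclideanLin ((leadingColumns i V')ᵀ * R)).ker ≠ ⊥ := by
    apply LinearMap.ker_ne_bot_of_finrank_lt
    rw [finrank_euclideanSpace, finrank_euclideanSpace, card_subtype_val_lt hi]
    exact Nat.lt_succ_of_le card_subtype_val_lt_le
  obtain ⟨z, hz, hz0⟩ := Submodule.exists_mem_ne_zero_of_ne_bot hker
  rw [LinearMap.mem_ker, toEuclideanLin_mul_apply] at hz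
  have h1 := h.le_norm_apply_leadingColumns i z
  have h2 := h'.norm_apply_le_of_leadingColumns_eq_zero hz
  rw [norm_toEuclideanLin_of_transpose_mul_self (h.leadingColumns_orthonormal _)] at h2
  have h3 : d i * ‖z‖ ≤ a * d' i * ‖z‖ := by
    rw [mul_assoc]
    exact h1.trans ((hle _).trans (mul_le_mul_of_nonneg_left h2 ha))
  exact le_of_mul_le_mul_right h3 (norm_pos_iff.mpr hz0)

/-- This identifies the diagonal of an arbitrary compact SVD, padded by zeros, with the values
`sigma`, although the two systems may have different numbers of columns. -/
theorem eq_of_isRightSingularSystem {r' : ℕ} {V' : Matrix (Fin q) (Fin r') ℝ} {d' : ℕ → ℝ}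
    (h : IsRightSingularSystem M V d) (h' : IsRightSingularSystem M V' d') : d = d' := by
  funext i
  apply le_antisymm
  · simpa using h.le_mul_of_norm_le h' zero_le_one (fun x => (one_mul _).ge) i
  · simpa using h'.le_mul_of_norm_le h zero_le_one (fun x => (one_mul _).ge) i

end IsRightSingularSystem

theorem exists_isRightSingularSystem {p q : ℕ} (M : Matrix (Fin p) (Fin q) ℝ) :
    ∃ V : Matrix (Fin q) (Fin q) ℝ,
      IsRightSingularSystem M V (fun i => sigma M (i + 1)) := by
  set T := Matrix.toEuclideanLin M with hT
  have hq : Module.finrank ℝ (EuclideanSpace ℝ (Fin q)) = q := finrank_euclideanSpace_fin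
  obtain ⟨v, hv⟩ : ∃ v : OrthonormalBasis (Fin q) ℝ (EuclideanSpace ℝ (Fin q)), ∀ j,
      Matrix.toEuclideanLin (Mᵀ * M) (v j) = sigma M (j + 1) ^ 2 • v j := by
    refine ⟨T.isSymmetric_adjoint_comp_self.eigenvectorBasis hq, fun j => ?_⟩
    have h1 := T.isSymmetric_adjoint_comp_self.apply_eigenvectorBasis hq j
    rw [← T.sq_singularValues_fin, LinearMap.comp_apply] at h1
    rw [Matrix.toEuclideanLin_mul_apply, ← Matrix.conjTranspose_eq_transpose_of_trivial,
      Matrix.toEuclideanLin_conjTranspose_eq_adjoint]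
    exact h1
  let V : Matrix (Fin q) (Fin q) ℝ := Matrix.of fun i j => v j i
  have hVV : Vᵀ * V = 1 := by
    ext i j
    have := orthonormal_iff_ite.mp v.orthonormal i j
    rw [Matrix.one_apply, ← this, Matrix.mul_apply, PiLp.inner_apply]
    exact Finset.sum_congr rfl fun k _ => mul_comm (v i k) (v j k)
  refine ⟨V, hVV, fun i j hij => T.singularValues_antitone (by simpa using hij),
    fun i => T.singularValues_nonneg _, fun i hi =>
      T.singularValues_of_finrank_le (by simpa using hi), ?_⟩
  have hVV' : V * Vᵀ = 1 := mul_eq_one_comm.mp hVV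
  have key : Mᵀ * M * V = V * Matrix.diagonal (fun i : Fin q => sigma M (i + 1) ^ 2) := by
    ext i j
    rw [Matrix.mul_diagonal, mul_comm]
    exact congrArg (fun x : EuclideanSpace ℝ (Fin q) => x i) (hv j)
  rw [← key, Matrix.mul_assoc, hVV', Matrix.mul_one]

theorem IsCompactSVD.isRightSingularSystem {p q r : ℕ} {M : Matrix (Fin p) (Fin q) ℝ}
    {U : Matrix (Fin p) (Fin r) ℝ} {d : Fin r → ℝ} {V : Matrix (Fin q) (Fin r) ℝ}
    (h : IsCompactSVD M U d V) :
    IsRightSingularSystem M V (fun i => if hi : i < r then d ⟨i, hi⟩ else 0) where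
  orthonormal := h.right_orthonormal
  antitone := by
    intro i j hij
    beta_reduce
    split_ifs with hj hi hi
    · exact h.diag_antitone hij
    · omega
    · exact (h.diag_pos _).le
    · exact le_rfl
  nonneg i := by
    split_ifs
    · exact (h.diag_pos _).le
    · exact le_rfl
  eq_zero i hi := dif_neg (by omega)
  gram := by
    rw [h.eq_mul]
    simp only [Matrix.transpose_mul, Matrix.transpose_transpose, Matrix.diagonal_transpose,
      Fin.is_lt, dite_true]
    calc _ = V * (Matrix.diagonal d * (Uᵀ * U) * Matrix.diagonal d) * Vᵀ := by
          simp only [Matrix.mul_assoc]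
      _ = _ := by
          rw [h.left_orthonormal, Matrix.mul_one, Matrix.diagonal_mul_diagonal]
          simp only [sq, Fin.eta]

theorem sigma_nonneg {p q : ℕ} (M : Matrix (Fin p) (Fin q) ℝ) (i : ℕ) : 0 ≤ sigma M i :=
  LinearMap.singularValues_nonneg _ _

/-- Index `0` does no harm: truncated subtraction makes `sigma M 0 = sigma M 1`. -/
theorem sigma_antitone {p q : ℕ} (M : Matrix (Fin p) (Fin q) ℝ) : Antitone (sigma M) :=
  fun _ _ h => LinearMap.singularValues_antitone _ (Nat.sub_le_sub_right h 1)

theorem sigma_le_mul_of_norm_le {p p' q : ℕ} {M : Matrix (Fin p) (Fin q) ℝ}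
    {M' : Matrix (Fin p') (Fin q) ℝ} {a : ℝ} (ha : 0 ≤ a)
    (h : ∀ x, ‖Matrix.toEuclideanLin M x‖ ≤ a * ‖Matrix.toEuclideanLin M' x‖) {i : ℕ}
    (hi : 1 ≤ i) : sigma M i ≤ a * sigma M' i := by
  obtain ⟨V, hV⟩ := exists_isRightSingularSystem M
  obtain ⟨V', hV'⟩ := exists_isRightSingularSystem M'
  have := hV.le_mul_of_norm_le hV' ha h (i - 1)
  rwa [Nat.sub_add_cancel hi] at this

theorem effectiveRank_eq {p q : ℕ} {M : Matrix (Fin p) (Fin q) ℝ} {c : ℝ} {k : ℕ}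
    (hkq : k ≤ q) (hk : c * sigma M 1 < sigma M k) (hk' : sigma M (k + 1) ≤ c * sigma M 1) :
    effectiveRank c M = k := by
  have : ((Finset.Icc 1 q).filter fun i => c * sigma M 1 < sigma M i) = Finset.Icc 1 k := by
    ext i
    simp only [Finset.mem_filter, Finset.mem_Icc]
    constructor
    · rintro ⟨⟨h1, _⟩, h3⟩
      refine ⟨h1, ?_⟩
      by_contra! h
      exact absurd (h3.trans_le ((sigma_antitone M h).trans hk')) (lt_irrefl _)
    · rintro ⟨h1, h2⟩
      exact ⟨⟨h1, h2.trans hkq⟩, hk.trans_le (sigma_antitone M h2)⟩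
  rw [effectiveRank, this, Nat.card_Icc, Nat.add_sub_cancel]

/-! ### Best approximations of bounded rank -/

/-- The competitor is `M` composed with the projection onto its `k` leading right singular vectors.
This easy half of Eckart–Young is all that is needed about `B` besides its rank. -/
theorem IsBestRankApprox.norm_sub_le {p q k : ℕ} {M B : Matrix (Fin p) (Fin q) ℝ}
    (h : IsBestRankApprox M k B) : ‖M - B‖ ≤ sigma M (k + 1) := by
  obtain ⟨V, hV⟩ := exists_isRightSingularSystem M
  refine (h.2 (M * (leadingColumns k V * (leadingColumns k V)ᵀ)) ?_).trans
    (Matrix.l2_opNorm_le_bound (sigma_nonneg _ _) fun x => ?_)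
  · exact (Matrix.rank_mul_le_right _ _).trans ((Matrix.rank_mul_le_left _ _).trans
      ((Matrix.rank_le_card_width _).trans card_subtype_val_lt_le))
  · have := hV.norm_mul_one_sub_le k x
    rwa [← Matrix.toEuclideanLin_mul_apply, Matrix.mul_sub, Matrix.mul_one] at this

/-- The pseudoinverse of a best approximation of rank at most `k`. -/
theorem IsBestRankApprox.rank_eq_and_norm_pinv_le {p q k : ℕ} {M B : Matrix (Fin p) (Fin q) ℝ}
    (h : IsBestRankApprox M k B) (hk : 1 ≤ k) (hkq : k ≤ q)
    (hgap : sigma M (k + 1) < sigma M k) :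
    B.rank = k ∧ ‖pinv B‖ ≤ 1 / (sigma M k - sigma M (k + 1)) := by
  obtain ⟨V, hV⟩ := exists_isRightSingularSystem M
  obtain ⟨l, rfl⟩ : ∃ l, k = l + 1 := ⟨k - 1, by omega⟩
  have hR := hV.leadingColumns_orthonormal (l + 1)
  have := (pinv_spec B).rank_eq_and_norm_le (sub_pos.mpr hgap) hR (fun z => ?_)
    (by rw [card_subtype_val_lt hkq]; exact h.1)
  · rwa [card_subtype_val_lt hkq] at this
  have h1 := hV.le_norm_apply_leadingColumns l z
  set w := Matrix.toEuclideanLin (leadingColumns (l + 1) V) z with hw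
  have hwz : ‖w‖ = ‖z‖ := Matrix.norm_toEuclideanLin_of_transpose_mul_self hR z
  -- An arbitrary minimiser need not share singular vectors with `M`, so `B` is bounded below on
  -- those of `M` by the triangle inequality. Hence the difference `σ_k - σ_{k+1}` where a truncated
  -- SVD would give `σ_k`.
  have h2 : ‖Matrix.toEuclideanLin (M - B) w‖ ≤ sigma M (l + 1 + 1) * ‖z‖ := by
    rw [← hwz]
    exact (Matrix.norm_toEuclideanLin_le _ _).trans
      (mul_le_mul_of_nonneg_right h.norm_sub_le (norm_nonneg _))
  have h3 := norm_sub_norm_le (Matrix.toEuclideanLin M w) (Matrix.toEuclideanLin B w)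
  rw [← Matrix.toEuclideanLin_sub_apply] at h3
  rw [sub_mul]
  linarith

/-! ### The preconditioned problem and the final estimate -/

theorem truncatedPreconditioner_eq {q r : ℕ} (l : ℕ) (d : Fin r → ℝ)
    (V : Matrix (Fin q) (Fin r) ℝ) :
    truncatedPreconditioner l d V =
      leadingColumns l V * Matrix.diagonal fun i => (d i.val)⁻¹ := rfl

/-- An invertible change of basis does not affect the solution of the projected least squares
problem. -/
theorem isMoorePenrose_mul_pinv {m n ι : Type*} [Fintype m] [Fintype n] [Fintype ι]
    [DecidableEq ι] {A : Matrix m n ℝ} {R : Matrix n ι ℝ} {D E : Matrix ι ι ℝ}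
    (hR : Rᵀ * R = 1) (hDE : D * E = 1)
    (hinj : Function.Injective (Matrix.toEuclideanLin (A * R))) :
    IsMoorePenrose (A * (R * Rᵀ)) (R * D * pinv (A * (R * D))) := by
  set X := pinv (A * (R * D))
  have hX : IsMoorePenrose (A * (R * D)) X := pinv_spec _
  -- In `(ARD) X (ARD) = ARD` the right factor `D` cancels against `E` and the left factor `AR` by
  -- injectivity. So the row-space projection is `R Rᵀ`, whatever `D` is.
  have hcancel : D * (X * (A * R)) = 1 := by
    have h1 : A * R * (D * (X * (A * R))) = A * R * (1 : Matrix ι ι ℝ) := by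
      calc _ = A * (R * D) * X * (A * (R * D)) * E := by
            simp only [Matrix.mul_assoc, hDE, Matrix.mul_one]
        _ = _ := by
            rw [hX.mul_mul_self]
            simp only [Matrix.mul_assoc, hDE, Matrix.mul_one]
    apply Matrix.toEuclideanLin.injective
    ext1 z
    apply hinj
    rw [← Matrix.toEuclideanLin_mul_apply, h1, Matrix.toEuclideanLin_mul_apply]
  have hleft : A * (R * Rᵀ) * (R * D * X) = A * (R * D) * X := by
    calc _ = A * (R * (Rᵀ * R) * D) * X := by simp only [Matrix.mul_assoc]
      _ = _ := by rw [hR, Matrix.mul_one]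
  have hright : R * D * X * (A * (R * Rᵀ)) = R * Rᵀ := by
    calc _ = R * (D * (X * (A * R))) * Rᵀ := by simp only [Matrix.mul_assoc]
      _ = _ := by rw [hcancel, Matrix.mul_one]
  refine ⟨?_, ?_, ?_, ?_⟩
  · rw [Matrix.mul_assoc, hright]
    calc _ = A * (R * (Rᵀ * R) * Rᵀ) := by simp only [Matrix.mul_assoc]
      _ = _ := by rw [hR, Matrix.mul_one]
  · rw [hright]
    calc _ = R * (Rᵀ * R) * D * X := by simp only [Matrix.mul_assoc]
      _ = _ := by rw [hR, Matrix.mul_one]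
  · rw [hleft, hX.left_symm]
  · rw [hright, Matrix.transpose_mul, Matrix.transpose_transpose]

/-- Used with `a = σ_k`, `t = σ_{k+1}`, `β = ‖b‖`. The `6` is `3 · 2`, where `2` comes from `(1 +
1/ρ)(aρ - t) = aρ + a - t - t/ρ ≤ 2(a - t)`. -/
theorem three_mul_le_six_mul_div {a t ρ β : ℝ} (hρ0 : 0 < ρ) (hρ1 : ρ ≤ 1) (ha : 0 < a)
    (ht : 0 ≤ t) (hta : t < a * ρ) (hβ : 0 ≤ β) :
    3 * (1 / (a - t) * (1 / (a * ρ)) * ((1 + 1 / ρ) * t)) * β ≤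
      6 * β / ((a * ρ) * (a * ρ - t)) * t := by
  have haρ : a * ρ ≤ a := mul_le_of_le_one_right ha.le hρ1
  have h1 : 0 < a - t := by linarith
  have h2 : 0 < a * ρ - t := by linarith
  have h3 : (1 + 1 / ρ) / (a - t) ≤ 2 / (a * ρ - t) := by
    rw [div_le_div_iff₀ h1 h2]
    have e : (1 + 1 / ρ) * (a * ρ - t) = a * ρ + a - t - t * (1 / ρ) := by
      field_simp
      ring
    have : t * 1 ≤ t * (1 / ρ) :=
      mul_le_mul_of_nonneg_left ((one_le_div hρ0).mpr hρ1) ht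
    linarith
  calc _ = 3 * β * t / (a * ρ) * ((1 + 1 / ρ) / (a - t)) := by ring
    _ ≤ 3 * β * t / (a * ρ) * (2 / (a * ρ - t)) :=
        mul_le_mul_of_nonneg_left h3 (by positivity)
    _ = _ := by
        field_simp
        ring

theorem theorem3p4 {m n s : ℕ} (A : Matrix (Fin m) (Fin n) ℝ) (S : Matrix (Fin s) (Fin m) ℝ)
    (b : EuclideanSpace ℝ (Fin m)) (k : ℕ) (hk : 1 ≤ k) (hkn : k < n)
    (ε c : ℝ) (hε0 : 0 < ε) (hε1 : ε < 1) (hc : 0 < c)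
    (hembed : ∀ x : EuclideanSpace ℝ (Fin n),
      1 / √(1 + ε) * ‖Matrix.toEuclideanLin (S * A) x‖ ≤ ‖Matrix.toEuclideanLin A x‖ ∧
      ‖Matrix.toEuclideanLin A x‖ ≤ 1 / √(1 - ε) * ‖Matrix.toEuclideanLin (S * A) x‖)
    (hsmall : sigma A (k + 1) < c * sigma A 1 * √((1 - ε) / (1 + ε)))
    (hlarge : c * sigma A 1 * (1 + √((1 + ε) / (1 - ε))) < sigma A k) :
    effectiveRank c (S * A) = k ∧
    ∀ (r : ℕ) (U : Matrix (Fin s) (Fin r) ℝ) (d : Fin r → ℝ) (V : Matrix (Fin n) (Fin r) ℝ),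
      IsCompactSVD (S * A) U d V →
      ∀ P, P = truncatedPreconditioner (effectiveRank c (S * A)) d V →
      ∀ Ak : Matrix (Fin m) (Fin n) ℝ, IsBestRankApprox A k Ak →
        ‖Matrix.toEuclideanLin (P * pinv (A * P)) b - Matrix.toEuclideanLin (pinv Ak) b‖ ≤
          6 * ‖b‖ / ((sigma A k * √((1 - ε) / (1 + ε))) *
            (sigma A k * √((1 - ε) / (1 + ε)) - sigma A (k + 1))) * sigma A (k + 1) := by
  set f := √(1 + ε) with hf
  set g := √(1 - ε) with hg
  have hf0 : 0 < f := Real.sqrt_pos.mpr (by linarith)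
  have hg0 : 0 < g := Real.sqrt_pos.mpr (by linarith)
  have hgf : g < f := Real.sqrt_lt_sqrt (by linarith) (by linarith)
  rw [Real.sqrt_div' _ (by linarith), ← hf, ← hg] at hsmall ⊢
  rw [Real.sqrt_div' _ (by linarith), ← hf, ← hg] at hlarge
  have hup : ∀ x, ‖Matrix.toEuclideanLin (S * A) x‖ ≤ f * ‖Matrix.toEuclideanLin A x‖ := by
    intro x
    have := (hembed x).1
    rwa [one_div, ← div_eq_inv_mul, div_le_iff₀' hf0] at this
  have hlo : ∀ x, ‖Matrix.toEuclideanLin A x‖ ≤ 1 / g * ‖Matrix.toEuclideanLin (S * A) x‖ :=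
    fun x => (hembed x).2
  have hsup : ∀ {i}, 1 ≤ i → sigma (S * A) i ≤ f * sigma A i :=
    fun hi => sigma_le_mul_of_norm_le hf0.le hup hi
  have hslo : ∀ {i}, 1 ≤ i → g * sigma A i ≤ sigma (S * A) i := by
    intro i hi
    have := sigma_le_mul_of_norm_le (by positivity) hlo hi
    rwa [one_div, ← div_eq_inv_mul, le_div_iff₀' hg0] at this
  have hs1 := sigma_nonneg A 1
  have hsk1 := sigma_nonneg A (k + 1)
  have hrank : effectiveRank c (S * A) = k := by
    refine effectiveRank_eq hkn.le ?_ ?_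
    · calc c * sigma (S * A) 1 ≤ c * (f * sigma A 1) :=
            mul_le_mul_of_nonneg_left (hsup le_rfl) hc.le
        _ ≤ g * (c * sigma A 1 * (1 + f / g)) := by
            -- The effective rank needs only the summand `f / g` of `hlarge`; the summand `1` is
            -- slack here.
            have : g * (c * sigma A 1 * (1 + f / g)) =
                c * (f * sigma A 1) + g * (c * sigma A 1) := by
              field_simp
              ring
            rw [this]
            exact le_add_of_nonneg_right (by positivity)
        _ < g * sigma A k := mul_lt_mul_of_pos_left hlarge hg0
        _ ≤ sigma (S * A) k := hslo hk
    · calc sigma (S * A) (k + 1) ≤ f * sigma A (k + 1) := hsup (by omega)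
        _ ≤ f * (c * sigma A 1 * (g / f)) := mul_le_mul_of_nonneg_left hsmall.le hf0.le
        _ = c * (g * sigma A 1) := by field_simp
        _ ≤ c * sigma (S * A) 1 := mul_le_mul_of_nonneg_left (hslo le_rfl) hc.le
  refine ⟨hrank, ?_⟩
  rintro r U d V hSVD P rfl Ak hAk
  rw [hrank]
  obtain ⟨l, rfl⟩ : ∃ l, k = l + 1 := ⟨k - 1, by omega⟩
  set P := truncatedPreconditioner (l + 1) d V with hP
  have hρ0 : 0 < g / f := div_pos hg0 hf0
  have hρ1 : g / f ≤ 1 := (div_le_one hf0).mpr hgf.le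
  have hck : c * sigma A 1 < sigma A (l + 1) := lt_of_le_of_lt
    (le_mul_of_one_le_right (by positivity) (by linarith [div_pos hf0 hg0])) hlarge
  have hσ0 : 0 < sigma A (l + 1) := lt_of_le_of_lt (by positivity) hck
  have hgap : sigma A (l + 1 + 1) < sigma A (l + 1) * (g / f) :=
    hsmall.trans (mul_lt_mul_of_pos_right hck hρ0)
  have hgap' : sigma A (l + 1 + 1) < sigma A (l + 1) :=
    hgap.trans_le (mul_le_of_le_one_right hσ0.le hρ1)
  have hsys := hSVD.isRightSingularSystem
  obtain ⟨V', hV'⟩ := exists_isRightSingularSystem (S * A)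
  rw [hsys.eq_of_isRightSingularSystem hV'] at hsys
  -- Ensures that the truncation really keeps `k` columns: otherwise the `k`-th singular value of
  -- `SA` would be zero, against the lower bound `g * σ_k > 0`.
  have hlr : l + 1 ≤ r := by
    by_contra! h
    have h0 := hsys.eq_zero l (by omega)
    have := hslo (i := l + 1) (by omega)
    rw [h0] at this
    exact absurd (mul_pos hg0 hσ0) this.not_gt
  have hcard := card_subtype_val_lt hlr
  have hR := hsys.leadingColumns_orthonormal (l + 1)
  have hlower := hsys.le_norm_apply_leadingColumns l
  have hres := hsys.norm_mul_one_sub_le (l + 1)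
  set R := leadingColumns (l + 1) V
  have hδ : 0 < sigma A (l + 1) * (g / f) := mul_pos hσ0 hρ0
  have hAR : ∀ z, sigma A (l + 1) * (g / f) * ‖z‖ ≤
      ‖Matrix.toEuclideanLin A (Matrix.toEuclideanLin R z)‖ := by
    intro z
    have h1 : g * sigma A (l + 1) * ‖z‖ ≤
        f * ‖Matrix.toEuclideanLin A (Matrix.toEuclideanLin R z)‖ :=
      (mul_le_mul_of_nonneg_right (hslo (by omega)) (norm_nonneg _)).trans
        ((hlower z).trans (hup _))
    rw [← div_le_iff₀' hf0] at h1
    exact le_trans (le_of_eq (by ring)) h1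
  have hinj : Function.Injective (Matrix.toEuclideanLin (A * R)) := by
    rw [injective_iff_map_eq_zero]
    intro z hz
    have := hAR z
    rw [← Matrix.toEuclideanLin_mul_apply, hz, norm_zero] at this
    rw [← norm_eq_zero]
    nlinarith [norm_nonneg z]
  have hMP : IsMoorePenrose (A * (R * Rᵀ)) (P * pinv (A * P)) := by
    rw [hP, truncatedPreconditioner_eq]
    refine isMoorePenrose_mul_pinv (E := Matrix.diagonal fun i => d i.val) hR ?_ hinj
    rw [Matrix.diagonal_mul_diagonal, ← Matrix.diagonal_one]
    congr 1
    funext i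
    exact inv_mul_cancel₀ (hSVD.diag_pos _).ne'
  obtain ⟨hNrank, hNnorm⟩ := hMP.rank_eq_and_norm_le hδ hR (fun z => by
      rw [← Matrix.toEuclideanLin_mul_apply, Matrix.mul_assoc, Matrix.mul_assoc, hR,
        Matrix.mul_one, Matrix.toEuclideanLin_mul_apply]
      exact hAR z)
    ((Matrix.rank_mul_le_right _ _).trans ((Matrix.rank_mul_le_left _ _).trans
      (Matrix.rank_le_card_width _)))
  obtain ⟨hBrank, hBnorm⟩ := hAk.rank_eq_and_norm_pinv_le hk hkn.le hgap'
  -- `R` is adapted to `SA`, not to `A`: the residual passes to `SA` at the cost `1 / g`, is bounded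
  -- there by the next singular value of `SA`, and returns to `A` at the cost `f`.
  have hAN : ‖A - A * (R * Rᵀ)‖ ≤ f / g * sigma A (l + 1 + 1) := by
    refine Matrix.l2_opNorm_le_bound (by positivity) fun x => ?_
    have h1 := (hlo _).trans (mul_le_mul_of_nonneg_left (hres x) (by positivity : 0 ≤ 1 / g))
    rw [← Matrix.toEuclideanLin_mul_apply, Matrix.mul_sub, Matrix.mul_one] at h1
    refine h1.trans ?_
    rw [← mul_assoc]
    refine mul_le_mul_of_nonneg_right ?_ (norm_nonneg _)
    calc _ ≤ 1 / g * (f * sigma A (l + 1 + 1)) :=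
          mul_le_mul_of_nonneg_left (hsup (by omega)) (by positivity)
      _ = _ := by ring
  have hdist : ‖Ak - A * (R * Rᵀ)‖ ≤ (1 + 1 / (g / f)) * sigma A (l + 1 + 1) := by
    have h1 := norm_add_le (Ak - A) (A - A * (R * Rᵀ))
    rw [sub_add_sub_cancel, norm_sub_rev Ak A] at h1
    rw [one_div_div, add_mul, one_mul]
    exact h1.trans (add_le_add hAk.norm_sub_le hAN)
  have hpert := (pinv_spec Ak).norm_sub_le_of_rank_eq hMP (by rw [hBrank, hNrank, hcard])
  rw [← Matrix.toEuclideanLin_sub_apply]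
  refine (Matrix.norm_toEuclideanLin_le _ _).trans ?_
  refine le_trans (mul_le_mul_of_nonneg_right (hpert.trans ?_) (norm_nonneg b))
    (three_mul_le_six_mul_div hρ0 hρ1 hσ0 hsk1 hgap (norm_nonneg b))
  have hB0 : 0 ≤ 1 / (sigma A (l + 1) - sigma A (l + 1 + 1)) :=
    one_div_nonneg.mpr (sub_pos.mpr hgap').le
  gcongr
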